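/- **Model.** A finite simple graph $G=(V,E)$ is revealed online, one vertex at a time. When a vertex $u$ arrives, the edges between $u$ and the previously arrived vertices are revealed; an online algorithm must then irrevocably fix the fractions $x_{uv}\ge 0$ for these edges, knowing only the graph revealed so far, so that in the end $x_u:=\sum_{v}x_{uv}\le 1$ for every vertex $u$. It is $\Gamma$-competitive if on every instance its total $\sum_{uv\in E}x_{uv}$ is at least $\Gamma$ times the maximum size of a fractional matching of $G$. **Algorithm.** Let $f:[0,1]\to[0,1]$ be continuous and strictly increasing, and let $g$ be continuous on $\{(a,x):0\le a\le x\le 1\}$, with values in $[0,1]$ and non-decreasing in $x$. The *history-based pricing algorithm* with functions $f,g$ works as follows. Let $x_v$ be the current matched portion (water level) of $v$, and let $a_v$ be the water level of $v$ at the end of its own arrival step. When $u$ arrives, $x_u=0$, and $u$ is continuously matched to its earlier neighbours $v$ with the currently cheapest price $g(a_v,x_v)$ (ties being broken arbitrarily) as long as $f(x_u)+g(a_v,x_v)\le 1$ for the cheapest $v$; when this stops, $a_u:=x_u$. **Theorem.** There are functions $f,g$ as above for which the history-based pricing algorithm is well defined (it can be carried out online) and, for every tie-breaking rule, is $0.526$-competitive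 for fractional online matching with general vertex arrival. Such functions exist with $g(x,x)=f(x)$ for all $x\in[0,1]$, and such functions (possibly different ones) also exist with $g$ non-decreasing in both arguments. -/

import Mathlib

open Set Filter Topology

/-- A fractional matching `X` of the simple graph `G`: `X u v` is the matched portion of the edge
`uv` (a feasible solution of the matching LP). -/
structure IsFractionalMatching {n : ℕ} (G : SimpleGraph (Fin n)) (X : Fin n → Fin n → ℝ) :
    Prop where
  symm : ∀ u v, X u v = X v u
  nonneg : ∀ u v, 0 ≤ X u v
  support : ∀ u v, ¬ G.Adj u v → X u v = 0
  capacity : ∀ u, ∑ v, X u v ≤ 1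

/-- The size of a fractional matching: each edge is counted once. -/
noncomputable def matchingSize {n : ℕ} (X : Fin n → Fin n → ℝ) : ℝ :=
  ∑ u, ∑ v ∈ Finset.Iio u, X u v

/-- A fractional online matching algorithm under general vertex arrival. The vertices
`0, 1, …, n - 1` arrive in this order, and the edges between an arriving vertex and the earlier
ones are revealed. The algorithm outputs a fractional matching on every graph, and its decisions
on the edges among the first `n` vertices depend only on the graph induced by these vertices
and are never changed when a further vertex arrives. -/
structure OnlineMatchingAlgorithm where
  out : ∀ n : ℕ, SimpleGraph (Fin n) → Fin n → Fin n → ℝ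
  feasible : ∀ (n : ℕ) (G : SimpleGraph (Fin n)), IsFractionalMatching G (out n G)
  online : ∀ (n : ℕ) (G : SimpleGraph (Fin (n + 1))) (u v : Fin n),
    out (n + 1) G u.castSucc v.castSucc = out n (G.comap Fin.castSucc) u v

/-- `A` is `Γ`-competitive: on every instance its solution is at least `Γ` times every fractional
matching, hence at least `Γ` times the optimum of the matching LP. -/
def OnlineMatchingAlgorithm.IsCompetitive (A : OnlineMatchingAlgorithm) (Γ : ℝ) : Prop :=
  ∀ (n : ℕ) (G : SimpleGraph (Fin n)) (Y : Fin n → Fin n → ℝ), IsFractionalMatching G Y →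
    Γ * matchingSize Y ≤ matchingSize (A.out n G)

/-- The water level of `v` just before the arrival of `u`: the total portion of `v` matched to
vertices on the arrivals of vertices preceding `u` (for `v` preceding `u`). -/
noncomputable def levelBefore {n : ℕ} (X : Fin n → Fin n → ℝ) (u v : Fin n) : ℝ :=
  ∑ w ∈ Finset.Iio u, X v w

/-- The active water level `a_v`: the portion of `v` matched on its own arrival. -/
noncomputable def activeLevel {n : ℕ} (X : Fin n → Fin n → ℝ) (v : Fin n) : ℝ :=
  ∑ w ∈ Finset.Iio v, X v w

/-- The continuous matching process on the arrival of a vertex `u` with set `N` of earlier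
neighbours, whose active levels are `a v` and whose water levels before the arrival are `x v`.
The process is parametrised by the water level `t` of `u`, running from `0` to `T`; `y t v` is the
portion of `uv` matched when `u` has water level `t`, so that `v` then has water level
`x v + y t v` and price `g (a v) (x v + y t v)`. -/
structure IsArrivalProcess {n : ℕ} (f : ℝ → ℝ) (g : ℝ → ℝ → ℝ) (N : Set (Fin n))
    (a x : Fin n → ℝ) (T : ℝ) (y : ℝ → Fin n → ℝ) : Prop where
  mem_Icc : T ∈ Icc (0 : ℝ) 1
  start : ∀ v, y 0 v = 0
  mono : ∀ v, MonotoneOn (fun t => y t v) (Icc 0 T)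
  support : ∀ t ∈ Icc 0 T, ∀ v, v ∉ N → y t v = 0
  total : ∀ t ∈ Icc 0 T, ∑ v, y t v = t
  capacity : ∀ v ∈ N, x v + y T v ≤ 1
  /-- Only cheapest neighbours are being matched: nothing is matched to `v` around a moment at
  which some neighbour is strictly cheaper than `v`. -/
  cheapest : ∀ t ∈ Icc 0 T, ∀ v ∈ N,
    (∃ w ∈ N, g (a w) (x w + y t w) < g (a v) (x v + y t v)) →
      ∀ᶠ s in 𝓝[Icc 0 T] t, y s v = y t v
  /-- The process runs only while the price of a cheapest neighbour plus `f` of the level of `u` is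
  at most one. -/
  running : ∀ t ∈ Ico 0 T, ∃ v ∈ N, f t + g (a v) (x v + y t v) ≤ 1
  /-- The process does not end before this sum reaches one: at its end no neighbour has a price
  below `1 - f T`. (As `f` is strictly increasing and prices never decrease, the process cannot be
  continued from such a state.) -/
  stopped : ∀ v ∈ N, 1 ≤ f T + g (a v) (x v + y T v)

/-- `X` is a possible output, on the graph `G` with arrival order `0, …, n - 1`, of the
history-based pricing algorithm with functions `f` and `g`, with ties between cheapest neighbours
broken in any way. -/
def IsHistoryPricingRun {n : ℕ} (f : ℝ → ℝ) (g : ℝ → ℝ → ℝ) (G : SimpleGraph (Fin n))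
    (X : Fin n → Fin n → ℝ) : Prop :=
  ∀ u, ∃ (T : ℝ) (y : ℝ → Fin n → ℝ),
    IsArrivalProcess f g {v | v < u ∧ G.Adj u v} (activeLevel X) (levelBefore X u) T y ∧
      ∀ v, v < u → X u v = y T v

/-- The online algorithm `A` is the history-based pricing algorithm with functions `f` and `g`,
for some rule of tie-breaking. -/
def OnlineMatchingAlgorithm.IsHistoryPricing (A : OnlineMatchingAlgorithm) (f : ℝ → ℝ)
    (g : ℝ → ℝ → ℝ) : Prop :=
  ∀ (n : ℕ) (G : SimpleGraph (Fin n)), IsHistoryPricingRun f g G (A.out n G)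

/-- The history-based pricing algorithm with functions `f` and `g` is well defined (it can be
carried out online), and it is `Γ`-competitive whatever the tie-breaking rule. -/
def HistoryPricingCompetitive (f : ℝ → ℝ) (g : ℝ → ℝ → ℝ) (Γ : ℝ) : Prop :=
  (∃ A : OnlineMatchingAlgorithm, A.IsHistoryPricing f g) ∧
    ∀ A : OnlineMatchingAlgorithm, A.IsHistoryPricing f g → A.IsCompetitive Γ

/-- The pairs `(a, x)` of an active level and a water level that can occur. -/
def levelPairs : Set (ℝ × ℝ) := {p | 0 ≤ p.1 ∧ p.1 ≤ p.2 ∧ p.2 ≤ 1}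

/-- Pricing functions: `f : [0,1] → [0,1]` is continuous and strictly increasing, and `g` is
continuous with values in `[0,1]` on the pairs `0 ≤ a ≤ x ≤ 1`, and non-decreasing in the water
level `x`. -/
structure IsPricing (f : ℝ → ℝ) (g : ℝ → ℝ → ℝ) : Prop where
  f_mapsTo : MapsTo f (Icc 0 1) (Icc 0 1)
  f_strictMono : StrictMonoOn f (Icc 0 1)
  f_continuous : ContinuousOn f (Icc 0 1)
  g_mapsTo : MapsTo (fun p : ℝ × ℝ => g p.1 p.2) levelPairs (Icc 0 1)
  g_continuous : ContinuousOn (fun p : ℝ × ℝ => g p.1 p.2) levelPairs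
  g_mono : ∀ a ∈ Icc (0 : ℝ) 1, MonotoneOn (g a) (Icc a 1)

/-!
The history plays no role in the algorithm used here: with a single pricing function `f`, the price
of a vertex at water level `x` is `g a x = f x`, so that both required properties of `g` are
immediate. The analysis is a primal-dual one, with the prices of the water levels as dual variables.

*Dual feasibility.* The process on the arrival of `u` stops only when `f x_u + f x_v ≥ 1` for every
earlier neighbour `v`, and levels never decrease. So the prices of the final levels form a
fractional vertex cover, which is at least as large as every fractional matching.

*Comparison.* It remains to show that an arrival which matches the amount `T` increases the sum of
all prices by at most `T / Γ`. The new vertex contributes `f T`. A neighbour is matched only at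
prices up to `1 - f T` (`IsArrivalProcess.price_add_le_one`), so that its price increases by at most
`m` per matched unit, where `m` bounds the slope of `f` up to the level `β` with `f β = 1 - f T`.
Hence it suffices that `f T + m T ≤ T / Γ`, which is the property `PaysForItself`.

*The pricing function.* Let `F` be the inverse of `f`; then `1 / m` is the slope of `F` at `1 - z`,
for `z = f T`, and equality in the condition reads `F' (1 - z) (F z / Γ - z) = F z`. It is solved by
`F z = Γ (z + σ z)` if `σ' (1 - z) = z / σ z`. The weighted geometric mean
`σ z = (z + 1 / 10) ^ (11 / 12) * (11 / 10 - z) ^ (1 / 12)` satisfies this equation, because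
`σ z * σ (1 - z) = (z + 1 / 10) (11 / 10 - z)`; and `F 1 = 1` forces `Γ = 1 / (1 + σ 1)`, which is
slightly larger than `0.526`. As `F 0 > 0`, this function is replaced by its minimum with
`10000 z`, at the cost of a small part of this margin. The bound on the slope needs no calculus: the
tangent line bound for `σ` is the inequality between geometric and arithmetic means.

*Existence.* On every arrival the process is carried out by water filling.
-/

/-! ### The pricing function -/

/-- The weighted geometric mean of `z + 1/10` and `11/10 - z` with weights `11/12` and `1/12`. -/
noncomputable def tiltedMean (z : ℝ) : ℝ :=
  (z + 1 / 10) ^ (11 / 12 : ℝ) * (11 / 10 - z) ^ (1 / 12 : ℝ)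

theorem tiltedMean_ge {z : ℝ} (hz : z ∈ Icc (0 : ℝ) 1) : 1 / 10 ≤ tiltedMean z := by
  have h : (1 / 10 : ℝ) = (1 / 10) ^ (11 / 12 : ℝ) * (1 / 10) ^ (1 / 12 : ℝ) := by
    rw [← Real.rpow_add (by norm_num)]; norm_num
  rw [h, tiltedMean]
  have := hz.1
  have := hz.2
  gcongr <;> linarith

theorem tiltedMean_pos {z : ℝ} (hz : z ∈ Icc (0 : ℝ) 1) : 0 < tiltedMean z :=
  lt_of_lt_of_le (by norm_num) (tiltedMean_ge hz)

theorem continuousOn_tiltedMean : ContinuousOn tiltedMean (Icc 0 1) := by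
  unfold tiltedMean
  apply ContinuousOn.mul
  · exact ContinuousOn.rpow_const (by fun_prop) fun x _ => Or.inr (by norm_num)
  · exact ContinuousOn.rpow_const (by fun_prop) fun x _ => Or.inr (by norm_num)

theorem tiltedMean_one_le : tiltedMean 1 ≤ 901 / 1000 := by
  have h0 : 0 ≤ tiltedMean 1 := (tiltedMean_pos ⟨zero_le_one, le_rfl⟩).le
  have h : tiltedMean 1 ^ 12 = (11 / 10) ^ 11 * (1 / 10) := by
    unfold tiltedMean
    rw [mul_pow, ← Real.rpow_mul_natCast (by norm_num), ← Real.rpow_mul_natCast (by norm_num),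
      show (11 / 12 : ℝ) * (12 : ℕ) = (11 : ℕ) by norm_num,
      show (1 / 12 : ℝ) * (12 : ℕ) = (1 : ℕ) by norm_num, Real.rpow_natCast, Real.rpow_natCast]
    norm_num
  refine le_of_pow_le_pow_left₀ (n := 12) (by norm_num) (by norm_num) ?_
  rw [h]
  norm_num

theorem tiltedMean_mul_tiltedMean_one_sub {z : ℝ} (hz : z ∈ Icc (0 : ℝ) 1) :
    tiltedMean z * tiltedMean (1 - z) = (z + 1 / 10) * (11 / 10 - z) := by
  have h1 : 0 < z + 1 / 10 := by linarith [hz.1]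
  have h2 : 0 < 11 / 10 - z := by linarith [hz.2]
  have e1 : 1 - z + 1 / 10 = 11 / 10 - z := by ring
  have e2 : 11 / 10 - (1 - z) = z + 1 / 10 := by ring
  unfold tiltedMean
  rw [e1, e2]
  calc _ = ((z + 1 / 10) ^ (11 / 12 : ℝ) * (z + 1 / 10) ^ (1 / 12 : ℝ)) *
        ((11 / 10 - z) ^ (11 / 12 : ℝ) * (11 / 10 - z) ^ (1 / 12 : ℝ)) := by ring
    _ = _ := by
      rw [← Real.rpow_add h1, ← Real.rpow_add h2]
      norm_num

/-- The ratio `z / tiltedMean z` is non-decreasing. -/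
theorem mul_tiltedMean_le_mul_tiltedMean {s t : ℝ} (hs : 0 ≤ s) (hst : s ≤ t) (ht : t ≤ 1) :
    s * tiltedMean t ≤ t * tiltedMean s := by
  have split : ∀ r : ℝ, 0 ≤ r → r = r ^ (11 / 12 : ℝ) * r ^ (1 / 12 : ℝ) := by
    intro r hr
    rw [← Real.rpow_add_of_nonneg hr (by norm_num) (by norm_num)]
    norm_num
  have key : ∀ r q : ℝ, 0 ≤ r → q ∈ Icc (0 : ℝ) 1 → r * tiltedMean q =
      (r * (q + 1 / 10)) ^ (11 / 12 : ℝ) * (r * (11 / 10 - q)) ^ (1 / 12 : ℝ) := by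
    intro r q hr hq
    have h1 : 0 ≤ q + 1 / 10 := by linarith [hq.1]
    have h2 : 0 ≤ 11 / 10 - q := by linarith [hq.2]
    rw [Real.mul_rpow hr h1, Real.mul_rpow hr h2]
    conv_lhs => rw [split r hr]
    unfold tiltedMean
    ring
  rw [key s t hs ⟨hs.trans hst, ht⟩, key t s (hs.trans hst) ⟨hs, hst.trans ht⟩]
  have h3 : 0 ≤ s * (11 / 10 - t) := mul_nonneg hs (by linarith)
  have h4 : 0 ≤ s * (t + 1 / 10) := mul_nonneg hs (by linarith)
  have h5 : 0 ≤ t * (s + 1 / 10) := mul_nonneg (hs.trans hst) (by linarith)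
  refine mul_le_mul (Real.rpow_le_rpow h4 (by nlinarith) (by norm_num))
    (Real.rpow_le_rpow h3 (by nlinarith) (by norm_num)) (by positivity) (by positivity)

/-- The slope of `tiltedMean` on `[0, s]` is at least its derivative at `s`: the tangent line bound
is the weighted inequality between the geometric and the arithmetic mean. -/
theorem slope_mul_le_tiltedMean_sub {r s : ℝ} (hr : 0 ≤ r) (hrs : r ≤ s) (hs : s ≤ 1) :
    (s - r) * ((1 - s) / tiltedMean (1 - s)) ≤ tiltedMean s - tiltedMean r := by
  have hsI : s ∈ Icc (0 : ℝ) 1 := ⟨hr.trans hrs, hs⟩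
  have h1 : 0 < s + 1 / 10 := by linarith
  have h2 : 0 < 11 / 10 - s := by linarith
  have h3 : 0 ≤ r + 1 / 10 := by linarith
  have h4 : 0 ≤ 11 / 10 - r := by linarith
  have hσ := tiltedMean_pos hsI
  have hσ' := tiltedMean_pos (z := 1 - s) ⟨by linarith, by linarith [hsI.1]⟩
  have amgm := Real.geom_mean_le_arith_mean2_weighted (w₁ := 11 / 12) (w₂ := 1 / 12)
    (p₁ := (r + 1 / 10) / (s + 1 / 10)) (p₂ := (11 / 10 - r) / (11 / 10 - s))
    (by norm_num) (by norm_num) (by positivity) (by positivity) (by norm_num)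
  rw [Real.div_rpow h3 h1.le, Real.div_rpow h4 h2.le, div_mul_div_comm] at amgm
  change tiltedMean r / tiltedMean s ≤ _ at amgm
  have e : (11 / 12 : ℝ) * ((r + 1 / 10) / (s + 1 / 10)) + 1 / 12 * ((11 / 10 - r) / (11 / 10 - s))
      = 1 - (s - r) * (1 - s) / ((s + 1 / 10) * (11 / 10 - s)) := by
    have e1 : r + 1 / 10 = s + 1 / 10 - (s - r) := by ring
    have e2 : 11 / 10 - r = 11 / 10 - s + (s - r) := by ring
    have e3 : 1 - s = (11 * (11 / 10 - s) - (s + 1 / 10)) / 12 := by ring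
    rw [e1, e2, e3]
    generalize s + 1 / 10 = p at h1
    generalize 11 / 10 - s = q at h2
    field_simp
    ring
  rw [e, ← tiltedMean_mul_tiltedMean_one_sub hsI, div_le_iff₀ hσ] at amgm
  have e2 : (1 - (s - r) * (1 - s) / (tiltedMean s * tiltedMean (1 - s))) * tiltedMean s
      = tiltedMean s - (s - r) * ((1 - s) / tiltedMean (1 - s)) := by
    field_simp
  linarith

/-- The inverse of the pricing function: the water level at which the price is `z`. The second
term alone would be positive at `z = 0`; the steep linear term brings the level of price `0` down to
`0`, so that the pricing function is strictly increasing on the whole of `[0, 1]`. -/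
noncomputable def priceLevel (z : ℝ) : ℝ :=
  min (10000 * z) ((z + tiltedMean z) / (1 + tiltedMean 1))

theorem priceLevel_zero : priceLevel 0 = 0 := by
  have h0 := tiltedMean_pos (z := 0) ⟨le_rfl, zero_le_one⟩
  have h1 := tiltedMean_pos (z := 1) ⟨zero_le_one, le_rfl⟩
  rw [priceLevel, mul_zero, min_eq_left]
  positivity

theorem priceLevel_one : priceLevel 1 = 1 := by
  have h1 := tiltedMean_pos (z := 1) ⟨zero_le_one, le_rfl⟩
  rw [priceLevel, div_self (by positivity)]
  norm_num

theorem continuousOn_priceLevel : ContinuousOn priceLevel (Icc 0 1) := by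
  unfold priceLevel
  have := continuousOn_tiltedMean
  exact ContinuousOn.inf (by fun_prop) (ContinuousOn.div_const (by fun_prop) _)

/-- The slope of `priceLevel` on `[0, 1 - z]`. -/
theorem slope_mul_le_priceLevel_sub {z r s : ℝ} (hz : 0 ≤ z) (hr : 0 ≤ r) (hrs : r ≤ s)
    (hs : s ≤ 1 - z) :
    (s - r) * ((1 + z / tiltedMean z) / (1 + tiltedMean 1)) ≤ priceLevel s - priceLevel r := by
  have hzI : z ∈ Icc (0 : ℝ) 1 := ⟨hz, by linarith⟩
  have h1 := tiltedMean_pos (z := 1) ⟨zero_le_one, le_rfl⟩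
  have hσ := tiltedMean_pos hzI
  have hσ' := tiltedMean_pos (z := 1 - s) ⟨by linarith, by linarith⟩
  have hratio : z / tiltedMean z ≤ (1 - s) / tiltedMean (1 - s) := by
    rw [div_le_div_iff₀ hσ hσ']
    exact mul_tiltedMean_le_mul_tiltedMean hz (by linarith) (by linarith)
  have hsr : 0 ≤ s - r := by linarith
  have hratio' : z / tiltedMean z ≤ 10 := by
    rw [div_le_iff₀ hσ]
    linarith [tiltedMean_ge hzI, hzI.2]
  rw [le_sub_iff_add_le]
  refine le_min ?_ ?_
  · have h2 : (1 + z / tiltedMean z) / (1 + tiltedMean 1) ≤ 10000 := by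
      rw [div_le_iff₀ (by positivity)]
      linarith
    have h3 : priceLevel r ≤ 10000 * r := min_le_left _ _
    nlinarith
  · have h3 : priceLevel r ≤ (r + tiltedMean r) / (1 + tiltedMean 1) := min_le_right _ _
    refine (add_le_add_right h3 _).trans ?_
    rw [← mul_div_assoc, ← add_div]
    refine div_le_div_of_nonneg_right ?_ (by positivity)
    have h4 := slope_mul_le_tiltedMean_sub hr hrs (by linarith)
    have h5 := mul_le_mul_of_nonneg_left hratio hsr
    linarith

theorem sub_le_priceLevel_sub {r s : ℝ} (hr : 0 ≤ r) (hrs : r ≤ s) (hs : s ≤ 1) :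
    (s - r) / (1 + tiltedMean 1) ≤ priceLevel s - priceLevel r := by
  have := slope_mul_le_priceLevel_sub le_rfl hr hrs (by linarith : s ≤ 1 - 0)
  simpa [div_eq_mul_inv] using this

theorem image_priceLevel : priceLevel '' Icc 0 1 = Icc 0 1 := by
  have h1 := tiltedMean_pos (z := 1) ⟨zero_le_one, le_rfl⟩
  apply Subset.antisymm
  · rintro _ ⟨z, hz, rfl⟩
    have ha := sub_le_priceLevel_sub le_rfl hz.1 hz.2
    have hb := sub_le_priceLevel_sub hz.1 hz.2 le_rfl
    rw [priceLevel_zero] at ha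
    rw [priceLevel_one] at hb
    have hc : 0 ≤ (z - 0) / (1 + tiltedMean 1) := div_nonneg (by linarith [hz.1]) (by positivity)
    have hd : 0 ≤ (1 - z) / (1 + tiltedMean 1) := div_nonneg (by linarith [hz.2]) (by positivity)
    exact ⟨by linarith, by linarith⟩
  · have := intermediate_value_Icc zero_le_one continuousOn_priceLevel
    rwa [priceLevel_zero, priceLevel_one] at this

/-- The pricing function: the price of a vertex as a function of its water level. Only its
values on `[0, 1]` matter. -/
noncomputable def levelPrice : ℝ → ℝ := Function.invFunOn priceLevel (Icc 0 1)

theorem levelPrice_mem {x : ℝ} (hx : x ∈ Icc (0 : ℝ) 1) : levelPrice x ∈ Icc (0 : ℝ) 1 :=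
  Function.invFunOn_mem (by rwa [← image_priceLevel] at hx)

theorem priceLevel_levelPrice {x : ℝ} (hx : x ∈ Icc (0 : ℝ) 1) : priceLevel (levelPrice x) = x :=
  Function.invFunOn_eq (by rwa [← image_priceLevel] at hx)

theorem levelPrice_strictMonoOn : StrictMonoOn levelPrice (Icc 0 1) := by
  have h1 := tiltedMean_pos (z := 1) ⟨zero_le_one, le_rfl⟩
  intro x hx y hy hxy
  by_contra! h
  have := sub_le_priceLevel_sub (levelPrice_mem hy).1 h (levelPrice_mem hx).2
  rw [priceLevel_levelPrice hx, priceLevel_levelPrice hy] at this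
  have hc : 0 ≤ (levelPrice x - levelPrice y) / (1 + tiltedMean 1) :=
    div_nonneg (by linarith) (by positivity)
  linarith

theorem levelPrice_zero : levelPrice 0 = 0 := by
  have h0 : (0 : ℝ) ∈ Icc (0 : ℝ) 1 := ⟨le_rfl, zero_le_one⟩
  have h1 := tiltedMean_pos (z := 1) ⟨zero_le_one, le_rfl⟩
  have := sub_le_priceLevel_sub le_rfl (levelPrice_mem h0).1 (levelPrice_mem h0).2
  rw [priceLevel_levelPrice h0, priceLevel_zero, div_le_iff₀ (by positivity)] at this
  linarith [(levelPrice_mem h0).1]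

theorem levelPrice_one : levelPrice 1 = 1 := by
  have h0 : (1 : ℝ) ∈ Icc (0 : ℝ) 1 := ⟨zero_le_one, le_rfl⟩
  have h1 := tiltedMean_pos (z := 1) ⟨zero_le_one, le_rfl⟩
  have := sub_le_priceLevel_sub (levelPrice_mem h0).1 (levelPrice_mem h0).2 le_rfl
  rw [priceLevel_levelPrice h0, priceLevel_one, div_le_iff₀ (by positivity)] at this
  linarith [(levelPrice_mem h0).2]

theorem continuousOn_levelPrice : ContinuousOn levelPrice (Icc 0 1) := by
  have h1 := tiltedMean_pos (z := 1) ⟨zero_le_one, le_rfl⟩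
  have key : ∀ x ∈ Icc (0 : ℝ) 1, ∀ y ∈ Icc (0 : ℝ) 1, x ≤ y →
      levelPrice y - levelPrice x ≤ (1 + tiltedMean 1) * (y - x) := by
    intro x hx y hy hxy
    have := sub_le_priceLevel_sub (levelPrice_mem hx).1
      (levelPrice_strictMonoOn.monotoneOn hx hy hxy) (levelPrice_mem hy).2
    rw [priceLevel_levelPrice hx, priceLevel_levelPrice hy, div_le_iff₀ (by positivity)] at this
    linarith
  refine (LipschitzOnWith.of_le_add_mul (Real.toNNReal (1 + tiltedMean 1))
    fun x hx y hy => ?_).continuousOn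
  rw [Real.coe_toNNReal _ (by positivity), Real.dist_eq]
  rcases le_total x y with h | h
  · have := levelPrice_strictMonoOn.monotoneOn hx hy h
    nlinarith [mul_nonneg (by positivity : 0 ≤ 1 + tiltedMean 1) (abs_nonneg (x - y))]
  · rw [abs_of_nonneg (sub_nonneg.2 h)]
    linarith [key y hy x hx h]

/-- A pricing function `f` pays for itself with factor `Γ` if for every level `T` there is a bound
`m` on the increase of `f` per unit, up to the level of price `1 - f T`, with `f T + m T ≤ T / Γ`:
the matched amount `T` of an arriving vertex then pays, at rate `1 / Γ`, for its own price and for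
the price increases of its neighbours. -/
def PaysForItself (f : ℝ → ℝ) (Γ : ℝ) : Prop :=
  ∀ T ∈ Icc (0 : ℝ) 1, ∃ m : ℝ, Γ * (f T + m * T) ≤ T ∧
    ∀ x w, 0 ≤ x → x ≤ w → w ≤ 1 → f w + f T ≤ 1 → f w - f x ≤ m * (w - x)

/-- The slope of the pricing function up to the price `1 - z` is at most the inverse of the slope
in `slope_mul_le_priceLevel_sub`. -/
theorem levelPrice_paysForItself : PaysForItself levelPrice 0.526 := by
  intro T hT
  set z := levelPrice T with hzdef
  have hz : z ∈ Icc (0 : ℝ) 1 := levelPrice_mem hT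
  have hTz : priceLevel z = T := priceLevel_levelPrice hT
  have h1 := tiltedMean_pos (z := 1) ⟨zero_le_one, le_rfl⟩
  have h1' := tiltedMean_one_le
  have hσ := tiltedMean_pos hz
  have hz0 := hz.1
  set κ := (1 + z / tiltedMean z) / (1 + tiltedMean 1) with hκ
  have hκ0 : 0 < κ := by positivity
  refine ⟨κ⁻¹, ?_, ?_⟩
  · have hT1 : T ≤ 10000 * z := hTz ▸ min_le_left _ _
    have hT2 : T ≤ (z + tiltedMean z) / (1 + tiltedMean 1) := hTz ▸ min_le_right _ _
    have hzκ : κ = (z + tiltedMean z) / (1 + tiltedMean 1) / tiltedMean z := by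
      rw [hκ]; field_simp; ring
    -- `κ⁻¹ T = (1 + tiltedMean 1) T - z T / E` with `E` the second term of `priceLevel z`
    set E := (z + tiltedMean z) / (1 + tiltedMean 1) with hE
    have hE0 : 0 < E := by positivity
    have hσE : tiltedMean z = (1 + tiltedMean 1) * E - z := by
      rw [hE]; field_simp; ring
    have hκE : κ⁻¹ * T = (1 + tiltedMean 1) * T - z * (T / E) := by
      rw [hzκ, inv_div, hσE]; field_simp
    have hz2 : z ≤ T / 10000 + z * (T / E) := by
      rcases min_choice (10000 * z) E with h | h
      · have : T = 10000 * z := by rw [← hTz, ← h]; rfl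
        have : 0 ≤ z * (T / E) := mul_nonneg hz0 (div_nonneg hT.1 hE0.le)
        linarith
      · have : T = E := by rw [← hTz, ← h]; rfl
        rw [this, div_self hE0.ne']
        linarith
    rw [hκE]
    have hT0 := hT.1
    -- the margin is `1901 / 1000 + 1 / 10000 ≤ 1 / 0.526`
    nlinarith [mul_le_mul_of_nonneg_right h1' hT.1]
  · intro x w hx hxw hw hwT
    have hxI : x ∈ Icc (0 : ℝ) 1 := ⟨hx, hxw.trans hw⟩
    have hwI : w ∈ Icc (0 : ℝ) 1 := ⟨hx.trans hxw, hw⟩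
    have := slope_mul_le_priceLevel_sub hz0 (levelPrice_mem hxI).1
      (levelPrice_strictMonoOn.monotoneOn hxI hwI hxw) (by linarith : levelPrice w ≤ 1 - z)
    rw [priceLevel_levelPrice hxI, priceLevel_levelPrice hwI, ← hκ] at this
    rw [inv_mul_eq_div, le_div_iff₀ hκ0]
    exact this

/-! ### The arrival of one vertex -/

namespace IsArrivalProcess

variable {n : ℕ} {f : ℝ → ℝ} {g : ℝ → ℝ → ℝ} {N : Set (Fin n)} {a x : Fin n → ℝ} {T : ℝ}
  {y : ℝ → Fin n → ℝ}

theorem sub_le_sub (h : IsArrivalProcess f g N a x T y) {s t : ℝ} (hs : s ∈ Icc 0 T)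
    (ht : t ∈ Icc 0 T) (hst : s ≤ t) (v : Fin n) : y t v - y s v ≤ t - s := by
  have := Finset.single_le_sum (f := fun v => y t v - y s v)
    (fun i _ => sub_nonneg.2 (h.mono i hs ht hst)) (Finset.mem_univ v)
  rwa [Finset.sum_sub_distrib, h.total t ht, h.total s hs] at this

theorem continuousOn (h : IsArrivalProcess f g N a x T y) (v : Fin n) :
    ContinuousOn (fun t => y t v) (Icc 0 T) := by
  refine (LipschitzOnWith.of_le_add_mul 1 fun s hs t ht => ?_).continuousOn
  rw [NNReal.coe_one, one_mul, Real.dist_eq]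
  rcases le_total s t with hst | hst
  · have := h.mono v hs ht hst
    have := abs_nonneg (s - t)
    dsimp only at *
    linarith
  · have := h.sub_le_sub ht hs hst v
    have := le_abs_self (s - t)
    linarith

theorem nonneg (h : IsArrivalProcess f g N a x T y) {t : ℝ} (ht : t ∈ Icc 0 T) (v : Fin n) :
    0 ≤ y t v := by
  have := h.mono v ⟨le_rfl, h.mem_Icc.1⟩ ht ht.1
  simpa [h.start] using this

theorem level_mem_Icc (h : IsArrivalProcess f g N a x T y) (hx : ∀ v, 0 ≤ x v) {t : ℝ}
    (ht : t ∈ Icc 0 T) {v : Fin n} (hv : v ∈ N) : x v + y t v ∈ Icc (0 : ℝ) 1 := by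
  have h1 := h.mono v ht ⟨ht.1.trans ht.2, le_rfl⟩ ht.2
  have h2 := h.capacity v hv
  dsimp only at h1
  exact ⟨add_nonneg (hx v) (h.nonneg ht v), by linarith⟩

/-- At the end of the process, every neighbour that was matched at all has price at most
`1 - f T`: it was a cheapest neighbour when it was last matched, its own price has not changed
since, and the price of the other neighbours never decreases. -/
theorem price_add_le_one (h : IsArrivalProcess f (fun _ x => f x) N a x T y)
    (hmono : StrictMonoOn f (Icc 0 1)) (hcont : ContinuousOn f (Icc 0 1)) (hx : ∀ v, 0 ≤ x v)
    {v : Fin n} (hv : v ∈ N) (hy : 0 < y T v) : f (x v + y T v) + f T ≤ 1 := by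
  have hT0 : 0 < T := by
    rcases h.mem_Icc.1.eq_or_lt with h0 | h0
    · rw [← h0, h.start] at hy
      exact absurd hy (lt_irrefl 0)
    · exact h0
  have hTT : T ∈ Icc 0 T := ⟨hT0.le, le_rfl⟩
  have hpc : ∀ w ∈ N, ContinuousOn (fun t => f t + f (x w + y t w)) (Icc 0 T) := by
    intro w hw
    refine (hcont.mono (Icc_subset_Icc_right h.mem_Icc.2)).add
      (hcont.comp (continuousOn_const.add (h.continuousOn w)) fun t ht => ?_)
    exact h.level_mem_Icc hx ht hw
  -- the cheapest price at the end
  obtain ⟨u, hu, hule⟩ : ∃ u ∈ N, f T + f (x u + y T u) ≤ 1 := by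
    by_contra! hcon
    have hev : ∀ᶠ t in 𝓝[Ico 0 T] T, ∀ w ∈ N, 1 < f t + f (x w + y t w) := by
      refine eventually_all.2 fun w => ?_
      by_cases hw : w ∈ N
      · have h1 := (hpc w hw T hTT).eventually_const_lt (hcon w hw)
        filter_upwards [nhdsWithin_mono T Ico_subset_Icc_self h1] with t ht _ using ht
      · exact Eventually.of_forall fun t hw' => absurd hw' hw
    have hne : (𝓝[Ico 0 T] T).NeBot := by
      rw [← mem_closure_iff_nhdsWithin_neBot, closure_Ico hT0.ne]
      exact hTT
    obtain ⟨t, ht, htI⟩ := (hev.and self_mem_nhdsWithin).exists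
    obtain ⟨w, hw, hle⟩ := h.running t htI
    exact absurd hle (not_le.2 (ht w hw))
  -- the first time `t₀` at which `v` has reached its final level
  set S := {t ∈ Icc 0 T | y T v ≤ y t v} with hS
  have hSclosed : IsClosed S := by
    rw [hS]
    exact isClosed_Icc.isClosed_le continuousOn_const (h.continuousOn v)
  have hSne : S.Nonempty := ⟨T, hTT, le_rfl⟩
  have hSbdd : BddBelow S := ⟨0, fun t ht => ht.1.1⟩
  have ht₀ : sInf S ∈ S := hSclosed.csInf_mem hSne hSbdd
  set t₀ := sInf S
  have ht₀y : y t₀ v = y T v := le_antisymm (h.mono v ht₀.1 hTT ht₀.1.2) ht₀.2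
  have ht₀pos : 0 < t₀ := by
    rcases ht₀.1.1.eq_or_lt with h0 | h0
    · rw [← h0, h.start] at ht₀y
      exact absurd ht₀y hy.ne
    · exact h0
  have hcheap : f (x v + y t₀ v) ≤ f (x u + y t₀ u) := by
    by_contra! hcon
    have hev := h.cheapest t₀ ht₀.1 v hv ⟨u, hu, hcon⟩
    have hne : (𝓝[Ico 0 t₀] t₀).NeBot := by
      rw [← mem_closure_iff_nhdsWithin_neBot, closure_Ico ht₀pos.ne]
      exact ⟨ht₀pos.le, le_rfl⟩
    have hsub : Ico 0 t₀ ⊆ Icc 0 T := fun s hs => ⟨hs.1, hs.2.le.trans ht₀.1.2⟩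
    have hev' := hev.filter_mono (nhdsWithin_mono t₀ hsub)
    obtain ⟨s, hs, hsI⟩ := (hev'.and self_mem_nhdsWithin).exists
    have : s ∈ S := ⟨hsub hsI, by rw [hs, ht₀y]⟩
    exact absurd (csInf_le hSbdd this) (not_le.2 hsI.2)
  have hu' : f (x u + y t₀ u) ≤ f (x u + y T u) :=
    hmono.monotoneOn (h.level_mem_Icc hx ht₀.1 hu) (h.level_mem_Icc hx hTT hu)
      (add_le_add_right (h.mono u ht₀.1 hTT ht₀.1.2) _)
  rw [ht₀y] at hcheap
  linarith

/-- The amount matched on an arrival is at least `Γ` times the value of the new vertex plus the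
increase of the values of the earlier vertices, values being prices of final levels. -/
theorem mul_gain_le (h : IsArrivalProcess f (fun _ x => f x) N a x T y)
    (hmono : StrictMonoOn f (Icc 0 1)) (hcont : ContinuousOn f (Icc 0 1)) {Γ : ℝ} (hΓ : 0 ≤ Γ)
    (hpay : PaysForItself f Γ) (hx : ∀ v, 0 ≤ x v) :
    Γ * (f T + ∑ v, (f (x v + y T v) - f (x v))) ≤ T := by
  obtain ⟨m, hm, hslope⟩ := hpay T h.mem_Icc
  have hTT : T ∈ Icc 0 T := ⟨h.mem_Icc.1, le_rfl⟩
  refine le_trans (mul_le_mul_of_nonneg_left (add_le_add_right ?_ _) hΓ) hm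
  nth_rewrite 2 [← h.total T hTT]
  rw [Finset.mul_sum]
  refine Finset.sum_le_sum fun v _ => ?_
  rcases (h.nonneg hTT v).eq_or_lt with h0 | h0
  · simp [← h0]
  · have hv : v ∈ N := by
      by_contra hv
      exact absurd (h.support T hTT v hv) h0.ne'
    have := hslope (x v) (x v + y T v) (hx v) (by linarith) (h.capacity v hv)
      (h.price_add_le_one hmono hcont hx hv h0)
    simpa using this

end IsArrivalProcess

/-! ### Competitiveness -/

theorem sum_Iio_last {n : ℕ} (F : Fin (n + 1) → ℝ) :
    ∑ w ∈ Finset.Iio (Fin.last n), F w = ∑ w : Fin n, F w.castSucc := by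
  rw [Fin.Iio_last_eq_map, Finset.sum_map]
  rfl

theorem matchingSize_succ {n : ℕ} (X : Fin (n + 1) → Fin (n + 1) → ℝ) :
    matchingSize X = matchingSize (fun u v : Fin n => X u.castSucc v.castSucc) +
      ∑ v : Fin n, X (Fin.last n) v.castSucc := by
  simp only [matchingSize, Fin.sum_univ_castSucc, Fin.sum_Iio_castSucc, sum_Iio_last]

/-- Each edge is counted twice in the sum over all ordered pairs. -/
theorem sum_sum_eq_two_mul_matchingSize {n : ℕ} {X : Fin n → Fin n → ℝ}
    (symm : ∀ u v, X u v = X v u) (diag : ∀ u, X u u = 0) :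
    ∑ u, ∑ v, X u v = 2 * matchingSize X := by
  induction n with
  | zero => simp [matchingSize]
  | succ n ih =>
    rw [matchingSize_succ, mul_add, ← ih (fun u v => symm _ _) fun u => diag _]
    simp only [Fin.sum_univ_castSucc, Finset.sum_add_distrib, diag]
    simp only [symm _ (Fin.last n)]
    ring

/-- Weak duality: a fractional matching is at most as large as a fractional vertex cover. -/
theorem IsFractionalMatching.matchingSize_le_sum {n : ℕ} {G : SimpleGraph (Fin n)}
    {Y : Fin n → Fin n → ℝ} (hY : IsFractionalMatching G Y) {c : Fin n → ℝ} (hc : ∀ u, 0 ≤ c u)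
    (hcover : ∀ u v, G.Adj u v → 1 ≤ c u + c v) : matchingSize Y ≤ ∑ u, c u := by
  have h1 : ∑ u, ∑ v, Y u v ≤ ∑ u, ∑ v, (c u + c v) * Y u v := by
    refine Finset.sum_le_sum fun u _ => Finset.sum_le_sum fun v _ => ?_
    by_cases huv : G.Adj u v
    · exact le_mul_of_one_le_left (hY.nonneg u v) (hcover u v huv)
    · simp [hY.support u v huv]
  have h2 : ∑ u, ∑ v, c u * Y u v ≤ ∑ u, c u := by
    refine Finset.sum_le_sum fun u _ => ?_
    rw [← Finset.mul_sum]
    exact mul_le_of_le_one_right (hc u) (hY.capacity u)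
  have h3 : ∑ u, ∑ v, c v * Y u v = ∑ u, ∑ v, c u * Y u v := by
    rw [Finset.sum_comm]
    simp only [hY.symm]
  rw [sum_sum_eq_two_mul_matchingSize hY.symm fun u => hY.support u u (G.loopless.irrefl u)] at h1
  simp only [add_mul, Finset.sum_add_distrib, h3] at h1
  linarith

theorem IsFractionalMatching.level_mem_Icc {n : ℕ} {G : SimpleGraph (Fin n)}
    {Y : Fin n → Fin n → ℝ} (hY : IsFractionalMatching G Y) (v : Fin n) :
    ∑ w, Y v w ∈ Icc (0 : ℝ) 1 :=
  ⟨Finset.sum_nonneg fun w _ => hY.nonneg v w, hY.capacity v⟩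

namespace OnlineMatchingAlgorithm

variable {A : OnlineMatchingAlgorithm} {f : ℝ → ℝ}

theorem level_castSucc (A : OnlineMatchingAlgorithm) {n : ℕ} (G : SimpleGraph (Fin (n + 1)))
    (v : Fin n) : ∑ w, A.out (n + 1) G v.castSucc w =
      ∑ w, A.out n (G.comap Fin.castSucc) v w + A.out (n + 1) G (Fin.last n) v.castSucc := by
  rw [Fin.sum_univ_castSucc, (A.feasible _ G).symm (Fin.last n)]
  simp only [A.online]

/-- The process on the arrival of the last vertex. The water levels before the arrival are the
final ones on the graph without the last vertex. -/
theorem IsHistoryPricing.exists_process (hA : A.IsHistoryPricing f fun _ x => f x) {n : ℕ}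
    (G : SimpleGraph (Fin (n + 1))) : ∃ (x : Fin (n + 1) → ℝ) (T : ℝ) (y : ℝ → Fin (n + 1) → ℝ),
      IsArrivalProcess f (fun _ x => f x) {v | v < Fin.last n ∧ G.Adj (Fin.last n) v}
        (activeLevel (A.out (n + 1) G)) x T y ∧ (∀ v, 0 ≤ x v) ∧
      T = ∑ w, A.out (n + 1) G (Fin.last n) w ∧
      ∀ v : Fin n, x v.castSucc = ∑ w, A.out n (G.comap Fin.castSucc) v w ∧
        y T v.castSucc = A.out (n + 1) G (Fin.last n) v.castSucc := by
  have hfeas := A.feasible (n + 1) G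
  obtain ⟨T, y, hp, hy⟩ := hA (n + 1) G (Fin.last n)
  have hTT : T ∈ Icc 0 T := ⟨hp.mem_Icc.1, le_rfl⟩
  refine ⟨_, T, y, hp, fun v => Finset.sum_nonneg fun w _ => hfeas.nonneg v w, ?_,
    fun v => ⟨?_, ?_⟩⟩
  · rw [Fin.sum_univ_castSucc, hfeas.support _ _ (G.loopless.irrefl _), ← hp.total T hTT,
      Fin.sum_univ_castSucc, hp.support T hTT (Fin.last n) (by simp)]
    simp only [hy _ (Fin.castSucc_lt_last _)]
  · rw [levelBefore, sum_Iio_last]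
    simp only [A.online]
  · exact (hy _ (Fin.castSucc_lt_last _)).symm

/-- The prices of the final water levels form a fractional vertex cover: the process on the arrival
of the later end of an edge stops only when the two prices add up to one. -/
theorem IsHistoryPricing.one_le_price_add_price (hA : A.IsHistoryPricing f fun _ x => f x)
    (hmono : StrictMonoOn f (Icc 0 1)) {n : ℕ} (G : SimpleGraph (Fin n)) {u v : Fin n}
    (huv : G.Adj u v) : 1 ≤ f (∑ w, A.out n G u w) + f (∑ w, A.out n G v w) := by
  induction n with
  | zero => exact u.elim0
  | succ n ih =>
    have hlast : ∀ v : Fin n, G.Adj (Fin.last n) v.castSucc →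
        1 ≤ f (∑ w, A.out (n + 1) G (Fin.last n) w) + f (∑ w, A.out (n + 1) G v.castSucc w) := by
      intro v hv
      obtain ⟨x, T, y, hp, -, hT, hxy⟩ := hA.exists_process G
      have := hp.stopped v.castSucc ⟨Fin.castSucc_lt_last v, hv⟩
      rwa [(hxy v).1, (hxy v).2, ← A.level_castSucc, hT] at this
    have hgrow : ∀ v : Fin n, f (∑ w, A.out n (G.comap Fin.castSucc) v w) ≤
        f (∑ w, A.out (n + 1) G v.castSucc w) := by
      intro v
      refine hmono.monotoneOn ((A.feasible n _).level_mem_Icc v)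
        ((A.feasible (n + 1) G).level_mem_Icc _) ?_
      rw [A.level_castSucc]
      exact le_add_of_nonneg_right ((A.feasible (n + 1) G).nonneg _ _)
    induction u using Fin.lastCases with
    | last =>
      induction v using Fin.lastCases with
      | last => exact absurd huv (G.loopless.irrefl _)
      | cast v => exact hlast v huv
    | cast u =>
      induction v using Fin.lastCases with
      | last =>
        rw [add_comm]
        exact hlast u huv.symm
      | cast v =>
        exact (ih (G.comap Fin.castSucc) (u := u) (v := v) huv).trans
          (add_le_add (hgrow u) (hgrow v))

/-- The matching is at least `Γ` times as large as the fractional vertex cover of prices, since this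
holds for the increments on every arrival. -/
theorem IsHistoryPricing.mul_sum_price_le (hA : A.IsHistoryPricing f fun _ x => f x)
    (hmono : StrictMonoOn f (Icc 0 1)) (hcont : ContinuousOn f (Icc 0 1)) {Γ : ℝ} (hΓ : 0 ≤ Γ)
    (hpay : PaysForItself f Γ) {n : ℕ} (G : SimpleGraph (Fin n)) :
    Γ * ∑ v, f (∑ w, A.out n G v w) ≤ matchingSize (A.out n G) := by
  induction n with
  | zero => simp [matchingSize]
  | succ n ih =>
    obtain ⟨x, T, y, hp, hx, hT, hxy⟩ := hA.exists_process G
    have hTT : T ∈ Icc 0 T := ⟨hp.mem_Icc.1, le_rfl⟩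
    have hgain := hp.mul_gain_le hmono hcont hΓ hpay hx
    rw [Fin.sum_univ_castSucc, hp.support T hTT (Fin.last n) (by simp), add_zero, sub_self,
      add_zero] at hgain
    simp only [(hxy _).1, (hxy _).2, ← A.level_castSucc, Finset.sum_sub_distrib] at hgain
    have ih' := ih (G.comap Fin.castSucc)
    have hsize := matchingSize_succ (A.out (n + 1) G)
    simp only [A.online] at hsize
    rw [Fin.sum_univ_castSucc, (A.feasible _ G).support _ _ (G.loopless.irrefl _), add_zero] at hT
    rw [Fin.sum_univ_castSucc, hsize]
    have hT' : f (∑ w, A.out (n + 1) G (Fin.last n) w) = f T := by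
      rw [hT, Fin.sum_univ_castSucc, (A.feasible _ G).support _ _ (G.loopless.irrefl _), add_zero]
    rw [hT', ← hT]
    linarith

theorem IsHistoryPricing.isCompetitive (hA : A.IsHistoryPricing f fun _ x => f x)
    (hmono : StrictMonoOn f (Icc 0 1)) (hcont : ContinuousOn f (Icc 0 1))
    (hnonneg : ∀ x ∈ Icc (0 : ℝ) 1, 0 ≤ f x) {Γ : ℝ} (hΓ : 0 ≤ Γ) (hpay : PaysForItself f Γ) :
    A.IsCompetitive Γ := by
  intro n G Y hY
  refine le_trans (mul_le_mul_of_nonneg_left ?_ hΓ) (hA.mul_sum_price_le hmono hcont hΓ hpay G)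
  exact hY.matchingSize_le_sum (fun u => hnonneg _ ((A.feasible n G).level_mem_Icc u))
    fun u v huv => hA.one_le_price_add_price hmono G huv

end OnlineMatchingAlgorithm

/-! ### Carrying out the algorithm -/

/-- Water filling: the portions by which the vertices of `N`, at water levels `x`, are raised when
all of them are filled up to the common level `l`. -/
noncomputable def waterFill {n : ℕ} (N : Set (Fin n)) (x : Fin n → ℝ) (l : ℝ) : Fin n → ℝ :=
  N.indicator fun v => max (l - x v) 0

section WaterFill

variable {n : ℕ} {N : Set (Fin n)} {x : Fin n → ℝ} {l : ℝ} {v : Fin n}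

theorem waterFill_of_notMem (hv : v ∉ N) : waterFill N x l v = 0 := indicator_of_notMem hv _

theorem waterFill_of_mem (hv : v ∈ N) : waterFill N x l v = max (l - x v) 0 :=
  indicator_of_mem hv _

theorem add_waterFill (hv : v ∈ N) : x v + waterFill N x l v = max l (x v) := by
  rw [waterFill_of_mem hv, ← max_add_add_left]
  simp

theorem monotone_waterFill : Monotone fun l => waterFill N x l v := by
  intro l l' h
  by_cases hv : v ∈ N
  · simp only [waterFill_of_mem hv]
    gcongr
  · simp [waterFill_of_notMem hv]

theorem continuous_sum_waterFill : Continuous fun l => ∑ v, waterFill N x l v := by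
  refine continuous_finsetSum _ fun v _ => ?_
  by_cases hv : v ∈ N
  · simp only [waterFill_of_mem hv]
    fun_prop
  · simp only [waterFill_of_notMem hv]
    fun_prop

theorem sub_le_sum_waterFill_sub {l' : ℝ} (hv : v ∈ N) (hl : x v ≤ l) (hll : l ≤ l') :
    l' - l ≤ ∑ w, waterFill N x l' w - ∑ w, waterFill N x l w := by
  rw [← Finset.sum_sub_distrib]
  have h := Finset.single_le_sum (f := fun w => waterFill N x l' w - waterFill N x l w)
    (fun i _ => sub_nonneg.2 (monotone_waterFill hll)) (Finset.mem_univ v)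
  refine le_trans ?_ h
  simp only [waterFill_of_mem hv]
  rw [max_eq_left (by linarith), max_eq_left (by linarith)]
  linarith

end WaterFill

/-- The continuous process on an arrival can be carried out, by water filling. The final level `l`
is found by the intermediate value theorem, and the level at time `t` by inverting the total amount
filled in. -/
theorem exists_isArrivalProcess {n : ℕ} {f : ℝ → ℝ} (hmono : StrictMonoOn f (Icc 0 1))
    (hcont : ContinuousOn f (Icc 0 1)) (h0 : f 0 = 0) (h1 : f 1 = 1) (N : Set (Fin n))
    (a x : Fin n → ℝ) (hx : ∀ v, x v ∈ Icc (0 : ℝ) 1) :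
    ∃ (T : ℝ) (y : ℝ → Fin n → ℝ), IsArrivalProcess f (fun _ x => f x) N a x T y := by
  rcases N.eq_empty_or_nonempty with rfl | hne
  · refine ⟨0, fun _ _ => 0, ⟨by simp, by simp, ?_, by simp, ?_, by simp, by simp, ?_, by simp⟩⟩
    · exact fun v s _ t _ _ => le_rfl
    · simp
    · simp
  have hnonneg : ∀ z ∈ Icc (0 : ℝ) 1, 0 ≤ f z := fun z hz =>
    h0 ▸ hmono.monotoneOn ⟨le_rfl, zero_le_one⟩ hz hz.1
  have hle : ∀ z ∈ Icc (0 : ℝ) 1, f z ≤ 1 := fun z hz =>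
    h1 ▸ hmono.monotoneOn hz ⟨zero_le_one, le_rfl⟩ hz.2
  obtain ⟨q, hq, hmin⟩ := N.exists_min_image x N.toFinite hne
  set W : ℝ → ℝ := fun l => ∑ v, waterFill N x l v with hW
  have hWq : W (x q) = 0 := by
    refine Finset.sum_eq_zero fun v _ => ?_
    by_cases hv : v ∈ N
    · rw [waterFill_of_mem hv, max_eq_right]
      linarith [hmin v hv]
    · exact waterFill_of_notMem hv
  have hWsub : ∀ l l', x q ≤ l → l ≤ l' → l' - l ≤ W l' - W l := fun l l' hl hll =>
    sub_le_sum_waterFill_sub hq hl hll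
  have hWcont : Continuous W := continuous_sum_waterFill
  have hWnonneg : ∀ l, x q ≤ l → 0 ≤ W l := by
    intro l hl
    have := hWsub (x q) l le_rfl hl
    linarith
  obtain ⟨l, hl, hfl⟩ : ∃ l ∈ Icc (x q) 1, f (min (W l) 1) + f l = 1 := by
    have hc : ContinuousOn (fun l => f (min (W l) 1) + f l) (Icc (x q) 1) := by
      refine ContinuousOn.add (hcont.comp (by fun_prop) fun l hl => ?_)
        (hcont.mono (Icc_subset_Icc_left (hx q).1))
      exact ⟨le_min (hWnonneg l hl.1) zero_le_one, min_le_right _ _⟩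
    refine intermediate_value_Icc (hx q).2 hc ⟨?_, ?_⟩
    · simpa [hWq, h0] using hle _ (hx q)
    · have := hnonneg (min (W 1) 1) ⟨le_min (hWnonneg 1 (hx q).2) zero_le_one, min_le_right _ _⟩
      simpa [h1] using this
  have hlI : l ∈ Icc (0 : ℝ) 1 := ⟨(hx q).1.trans hl.1, hl.2⟩
  have hT1 : W l ≤ 1 := by
    by_contra! hcon
    rw [min_eq_right hcon.le, h1] at hfl
    have hl0 : l = 0 := hmono.injOn hlI ⟨le_rfl, zero_le_one⟩ (by linarith)
    have hq0 : x q = 0 := le_antisymm (hl0 ▸ hl.1) (hx q).1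
    rw [hl0, ← hq0, hWq] at hcon
    linarith
  rw [min_eq_left hT1] at hfl
  set T := W l
  have hT0 : 0 ≤ T := hWnonneg l hl.1
  have hinv : ∀ t ∈ Icc 0 T, ∃ k ∈ Icc (x q) l, W k = t := by
    have := intermediate_value_Icc hl.1 hWcont.continuousOn
    rw [hWq] at this
    exact fun t ht => this ht
  choose! L hLmem hLW using hinv
  have hLmono : MonotoneOn L (Icc 0 T) := by
    intro s hs t ht hst
    by_contra! hcon
    have := hWsub _ _ (hLmem t ht).1 hcon.le
    rw [hLW s hs, hLW t ht] at this
    linarith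
  have hLcont : ContinuousOn L (Icc 0 T) := by
    refine (LipschitzOnWith.of_le_add_mul 1 fun s hs t ht => ?_).continuousOn
    rw [NNReal.coe_one, one_mul, Real.dist_eq]
    rcases le_total s t with hst | hst
    · linarith [hLmono hs ht hst, abs_nonneg (s - t)]
    · have := hWsub _ _ (hLmem t ht).1 (hLmono ht hs hst)
      rw [hLW s hs, hLW t ht] at this
      linarith [le_abs_self (s - t)]
  have h0T : (0 : ℝ) ∈ Icc 0 T := ⟨le_rfl, hT0⟩
  have hTT : T ∈ Icc 0 T := ⟨hT0, le_rfl⟩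
  have hL0 : L 0 = x q := by
    have := hWsub _ _ le_rfl (hLmem 0 h0T).1
    rw [hLW 0 h0T, hWq] at this
    linarith [(hLmem 0 h0T).1]
  have hLT : L T = l := by
    have := hWsub _ _ (hLmem T hTT).1 (hLmem T hTT).2
    rw [hLW T hTT] at this
    linarith [(hLmem T hTT).2]
  have hmaxI : ∀ t ∈ Icc 0 T, ∀ v, max (L t) (x v) ∈ Icc (0 : ℝ) 1 := fun t ht v =>
    ⟨(hx v).1.trans (le_max_right _ _), max_le ((hLmem t ht).2.trans hl.2) (hx v).2⟩
  refine ⟨T, fun t => waterFill N x (L t), ⟨⟨hT0, hT1⟩, ?_, ?_, ?_, ?_, ?_, ?_, ?_, ?_⟩⟩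
  · intro v
    rw [hL0]
    by_cases hv : v ∈ N
    · rw [waterFill_of_mem hv, max_eq_right]
      linarith [hmin v hv]
    · exact waterFill_of_notMem hv
  · exact fun v s hs t ht hst => monotone_waterFill (hLmono hs ht hst)
  · exact fun t _ v hv => waterFill_of_notMem hv
  · exact hLW
  · intro v hv
    rw [add_waterFill hv]
    exact (hmaxI T hTT v).2
  · rintro t ht v hv ⟨w, hw, hlt⟩
    simp only [add_waterFill hv, add_waterFill hw] at hlt
    rw [hmono.lt_iff_lt (hmaxI t ht w) (hmaxI t ht v)] at hlt
    have hLv : L t < x v := by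
      by_contra! hcon
      rw [max_eq_left hcon] at hlt
      exact absurd (le_max_left _ _) (not_le.2 hlt)
    filter_upwards [(hLcont t ht).eventually_lt_const hLv] with s hs
    rw [waterFill_of_mem hv, waterFill_of_mem hv, max_eq_right (by linarith),
      max_eq_right (by linarith)]
  · intro t ht
    have htI : t ∈ Icc 0 T := ⟨ht.1, ht.2.le⟩
    refine ⟨q, hq, ?_⟩
    simp only [add_waterFill hq]
    rw [max_eq_left (hLmem t htI).1, ← hfl]
    refine add_le_add (hmono.monotoneOn ⟨ht.1, ht.2.le.trans hT1⟩ ⟨hT0, hT1⟩ ht.2.le)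
      (hmono.monotoneOn ?_ hlI (hLmem t htI).2)
    exact ⟨(hx q).1.trans (hLmem t htI).1, (hLmem t htI).2.trans hl.2⟩
  · intro v hv
    simp only [add_waterFill hv]
    rw [← hfl, hLT]
    exact add_le_add_right (hmono.monotoneOn hlI (hLT ▸ hmaxI T hTT v) (le_max_left _ _)) _

/-- A process remains one when a further vertex, which is not a neighbour, is added. The active
levels play no role, as the prices do not depend on them. -/
theorem IsArrivalProcess.castSucc {n : ℕ} {f : ℝ → ℝ} {N : Set (Fin n)} {a x : Fin n → ℝ} {T : ℝ}
    {y : ℝ → Fin n → ℝ} (h : IsArrivalProcess f (fun _ x => f x) N a x T y)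
    (a' : Fin (n + 1) → ℝ) {x' : Fin (n + 1) → ℝ} (hx : ∀ v ∈ N, x' v.castSucc = x v) :
    IsArrivalProcess f (fun _ x => f x) (Fin.castSucc '' N) a' x' T
      (fun t => Fin.snoc (α := fun _ => ℝ) (y t) 0) where
  mem_Icc := h.mem_Icc
  start v := by
    induction v using Fin.lastCases with
    | last => simp
    | cast v => simpa using h.start v
  mono v := by
    induction v using Fin.lastCases with
    | last => simp [monotoneOn_const]
    | cast v => simpa using h.mono v
  support t ht v hv := by
    induction v using Fin.lastCases with
    | last => simp
    | cast v =>
      rw [Fin.snoc_castSucc]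
      exact h.support t ht v fun hv' => hv ⟨v, hv', rfl⟩
  total t ht := by simp [Fin.sum_univ_castSucc, h.total t ht]
  capacity := by
    rintro _ ⟨v, hv, rfl⟩
    simpa [hx v hv] using h.capacity v hv
  cheapest := by
    rintro t ht _ ⟨v, hv, rfl⟩ ⟨_, ⟨w, hw, rfl⟩, hlt⟩
    simp only [Fin.snoc_castSucc, hx v hv, hx w hw] at hlt ⊢
    exact h.cheapest t ht v hv ⟨w, hw, hlt⟩
  running t ht := by
    obtain ⟨v, hv, hle⟩ := h.running t ht
    refine ⟨v.castSucc, ⟨v, hv, rfl⟩, ?_⟩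
    simpa [hx v hv] using hle
  stopped := by
    rintro _ ⟨v, hv, rfl⟩
    simpa [hx v hv] using h.stopped v hv

/-- The fractional matching `X` extended by the portions `z` of the edges at a further vertex. -/
noncomputable def extendMatching {n : ℕ} (X : Fin n → Fin n → ℝ) (z : Fin n → ℝ) :
    Fin (n + 1) → Fin (n + 1) → ℝ :=
  Fin.snoc (α := fun _ => Fin (n + 1) → ℝ) (fun u => Fin.snoc (α := fun _ => ℝ) (X u) (z u))
    (Fin.snoc (α := fun _ => ℝ) z 0)

section ExtendMatching

variable {n : ℕ} (X : Fin n → Fin n → ℝ) (z : Fin n → ℝ) (u v : Fin n)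

theorem extendMatching_castSucc_castSucc : extendMatching X z u.castSucc v.castSucc = X u v := by
  simp [extendMatching]

theorem extendMatching_castSucc_last : extendMatching X z u.castSucc (Fin.last n) = z u := by
  simp [extendMatching]

theorem extendMatching_last_castSucc : extendMatching X z (Fin.last n) v.castSucc = z v := by
  simp [extendMatching]

theorem extendMatching_last_last : extendMatching X z (Fin.last n) (Fin.last n) = 0 := by
  simp [extendMatching]

theorem levelBefore_extendMatching_castSucc :
    levelBefore (extendMatching X z) u.castSucc v.castSucc = levelBefore X u v := by
  simp only [levelBefore, Fin.sum_Iio_castSucc, extendMatching_castSucc_castSucc]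

theorem levelBefore_extendMatching_last :
    levelBefore (extendMatching X z) (Fin.last n) v.castSucc = ∑ w, X v w := by
  simp only [levelBefore, sum_Iio_last, extendMatching_castSucc_castSucc]

end ExtendMatching

theorem IsFractionalMatching.extendMatching {n : ℕ} {G : SimpleGraph (Fin (n + 1))}
    {X : Fin n → Fin n → ℝ} (hX : IsFractionalMatching (G.comap Fin.castSucc) X) {z : Fin n → ℝ}
    (hz : ∀ v, 0 ≤ z v) (hz_adj : ∀ v, ¬ G.Adj (Fin.last n) v.castSucc → z v = 0)
    (hz_cap : ∀ v, ∑ w, X v w + z v ≤ 1) (hz_sum : ∑ v, z v ≤ 1) :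
    IsFractionalMatching G (extendMatching X z) where
  symm u v := by
    induction u using Fin.lastCases <;> induction v using Fin.lastCases <;>
      simp only [extendMatching_castSucc_castSucc, extendMatching_castSucc_last,
        extendMatching_last_castSucc]
    exact hX.symm _ _
  nonneg u v := by
    induction u using Fin.lastCases <;> induction v using Fin.lastCases <;>
      simp only [extendMatching_castSucc_castSucc, extendMatching_castSucc_last,
        extendMatching_last_castSucc, extendMatching_last_last, hX.nonneg, hz, le_refl]
  support u v huv := by
    induction u using Fin.lastCases with
    | last =>
      induction v using Fin.lastCases with
      | last => exact extendMatching_last_last X z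
      | cast v => rw [extendMatching_last_castSucc, hz_adj v huv]
    | cast u =>
      induction v using Fin.lastCases with
      | last => rw [extendMatching_castSucc_last, hz_adj u fun h => huv h.symm]
      | cast v => rw [extendMatching_castSucc_castSucc, hX.support u v huv]
  capacity u := by
    induction u using Fin.lastCases with
    | last => simpa [Fin.sum_univ_castSucc, extendMatching_last_castSucc,
        extendMatching_last_last] using hz_sum
    | cast u => simpa [Fin.sum_univ_castSucc, extendMatching_castSucc_castSucc,
        extendMatching_castSucc_last] using hz_cap u

/-- The run on the graph without the last vertex is continued by a process for the last vertex. -/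
theorem IsHistoryPricingRun.extendMatching {n : ℕ} {f : ℝ → ℝ} {G : SimpleGraph (Fin (n + 1))}
    {X : Fin n → Fin n → ℝ} (hX : IsHistoryPricingRun f (fun _ x => f x) (G.comap Fin.castSucc) X)
    {a : Fin n → ℝ} {T : ℝ} {y : ℝ → Fin n → ℝ}
    (hy : IsArrivalProcess f (fun _ x => f x) {v | G.Adj (Fin.last n) v.castSucc} a
      (fun v => ∑ w, X v w) T y) :
    IsHistoryPricingRun f (fun _ x => f x) G (extendMatching X (y T)) := by
  intro u
  induction u using Fin.lastCases with
  | last =>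
    refine ⟨T, fun t => Fin.snoc (α := fun _ => ℝ) (y t) 0, ?_, fun v hv => ?_⟩
    · convert hy.castSucc (activeLevel (_root_.extendMatching X (y T)))
        fun v _ => levelBefore_extendMatching_last X (y T) v using 1
      ext v
      induction v using Fin.lastCases <;> simp [Fin.castSucc_lt_last]
    · induction v using Fin.lastCases with
      | last => exact absurd hv (lt_irrefl _)
      | cast v => simp only [extendMatching_last_castSucc, Fin.snoc_castSucc]
  | cast u =>
    obtain ⟨T', y', hp, hy'⟩ := hX u
    refine ⟨T', fun t => Fin.snoc (α := fun _ => ℝ) (y' t) 0, ?_, fun v hv => ?_⟩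
    · convert hp.castSucc (activeLevel (_root_.extendMatching X (y T)))
        fun v _ => levelBefore_extendMatching_castSucc X (y T) u v using 1
      ext v
      induction v using Fin.lastCases <;> simp [(Fin.castSucc_lt_last u).le]
    · induction v using Fin.lastCases with
      | last => exact absurd hv (Fin.castSucc_lt_last u).not_gt
      | cast v =>
        simp only [extendMatching_castSucc_castSucc, Fin.snoc_castSucc]
        exact hy' v (Fin.castSucc_lt_castSucc_iff.1 hv)

/-- The output of the online algorithm that matches an arriving vertex, with set `N` of earlier
neighbours, to the earlier vertices in the portions `step n N x`, where `x` are the current water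
levels. -/
noncomputable def iterateArrivals (step : ∀ n, Set (Fin n) → (Fin n → ℝ) → Fin n → ℝ) :
    ∀ n, SimpleGraph (Fin n) → Fin n → Fin n → ℝ
  | 0, _ => fun _ _ => 0
  | n + 1, G => extendMatching (iterateArrivals step n (G.comap Fin.castSucc))
      (step n {v | G.Adj (Fin.last n) v.castSucc}
        fun v => ∑ w, iterateArrivals step n (G.comap Fin.castSucc) v w)

/-- The algorithm is well defined: there is an online algorithm all of whose runs are runs of
history-based pricing. -/
theorem exists_isHistoryPricing {f : ℝ → ℝ} (hmono : StrictMonoOn f (Icc 0 1))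
    (hcont : ContinuousOn f (Icc 0 1)) (h0 : f 0 = 0) (h1 : f 1 = 1) :
    ∃ A : OnlineMatchingAlgorithm, A.IsHistoryPricing f fun _ x => f x := by
  have hstep : ∀ (n : ℕ) (N : Set (Fin n)) (x : Fin n → ℝ), ∃ z : Fin n → ℝ,
      (∀ v, x v ∈ Icc (0 : ℝ) 1) → ∃ (T : ℝ) (y : ℝ → Fin n → ℝ),
        IsArrivalProcess f (fun _ x => f x) N 0 x T y ∧ z = y T := by
    intro n N x
    by_cases hx : ∀ v, x v ∈ Icc (0 : ℝ) 1
    · obtain ⟨T, y, h⟩ := exists_isArrivalProcess hmono hcont h0 h1 N 0 x hx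
      exact ⟨y T, fun _ => ⟨T, y, h, rfl⟩⟩
    · exact ⟨0, fun h => absurd h hx⟩
  choose step hstep using hstep
  have main : ∀ (n : ℕ) (G : SimpleGraph (Fin n)),
      IsFractionalMatching G (iterateArrivals step n G) ∧
      IsHistoryPricingRun f (fun _ x => f x) G (iterateArrivals step n G) := by
    intro n
    induction n with
    | zero => exact fun G => ⟨⟨fun u => u.elim0, fun u => u.elim0, fun u => u.elim0,
        fun u => u.elim0⟩, fun u => u.elim0⟩
    | succ n ih =>
      intro G
      obtain ⟨hfeas, hrun⟩ := ih (G.comap Fin.castSucc)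
      obtain ⟨T, y, hp, hz⟩ := hstep n {v | G.Adj (Fin.last n) v.castSucc} _
        fun v => hfeas.level_mem_Icc v
      have hTT : T ∈ Icc 0 T := ⟨hp.mem_Icc.1, le_rfl⟩
      rw [iterateArrivals, hz]
      refine ⟨hfeas.extendMatching (fun v => hp.nonneg hTT v) (fun v hv => hp.support T hTT v hv)
        (fun v => ?_) ((hp.total T hTT).trans_le hp.mem_Icc.2), hrun.extendMatching hp⟩
      by_cases hv : G.Adj (Fin.last n) v.castSucc
      · exact hp.capacity v hv
      · rw [hp.support T hTT v hv, add_zero]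
        exact hfeas.capacity v
  refine ⟨⟨iterateArrivals step, fun n G => (main n G).1, fun n G u v => ?_⟩,
    fun n G => (main n G).2⟩
  rw [iterateArrivals, extendMatching_castSucc_castSucc]

/-! ### Competitive history-based pricing -/

theorem isPricing_levelPrice : IsPricing levelPrice fun _ x => levelPrice x where
  f_mapsTo _ hx := levelPrice_mem hx
  f_strictMono := levelPrice_strictMonoOn
  f_continuous := continuousOn_levelPrice
  g_mapsTo _ hp := levelPrice_mem ⟨hp.1.trans hp.2.1, hp.2.2⟩
  g_continuous := continuousOn_levelPrice.comp continuousOn_snd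
    fun _ hp => ⟨hp.1.trans hp.2.1, hp.2.2⟩
  g_mono _ ha := levelPrice_strictMonoOn.monotoneOn.mono (Icc_subset_Icc_left ha.1)

theorem historyPricingCompetitive_levelPrice :
    HistoryPricingCompetitive levelPrice (fun _ x => levelPrice x) 0.526 :=
  ⟨exists_isHistoryPricing levelPrice_strictMonoOn continuousOn_levelPrice levelPrice_zero
    levelPrice_one, fun _ hA => hA.isCompetitive levelPrice_strictMonoOn continuousOn_levelPrice
    (fun _ hx => (levelPrice_mem hx).1) (by norm_num) levelPrice_paysForItself⟩

theorem mainTheorem4 :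
    (∃ (f : ℝ → ℝ) (g : ℝ → ℝ → ℝ), IsPricing f g ∧
      (∀ x ∈ Icc (0 : ℝ) 1, g x x = f x) ∧
      HistoryPricingCompetitive f g 0.526) ∧
    (∃ (f : ℝ → ℝ) (g : ℝ → ℝ → ℝ), IsPricing f g ∧
      (∀ x ∈ Icc (0 : ℝ) 1, MonotoneOn (fun a => g a x) (Icc 0 x)) ∧
      HistoryPricingCompetitive f g 0.526) := by
  refine ⟨⟨levelPrice, fun _ x => levelPrice x, isPricing_levelPrice, fun _ _ => rfl, ?_⟩,
    ⟨levelPrice, fun _ x => levelPrice x, isPricing_levelPrice, fun _ _ => monotoneOn_const, ?_⟩⟩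
  · exact historyPricingCompetitive_levelPrice
  · exact historyPricingCompetitive_levelPrice
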